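/- Algebras are algebras of a fixed signature of finitary operation symbols; a variety is a class of algebras given by identities; $\mathrm{Var}(H)$ is the variety generated by an algebra $H$ (all identities of $H$). For a variety $\Theta$, $W(X)=W_\Theta(X)$ denotes the free algebra of $\Theta$ on $X$, and $\Theta^0$ is the category of the free algebras $W(X)$, $X$ a non-empty finite set, with all homomorphisms. A variety is called regular if any two non-empty finite systems of free generators (as subsets) of one and the same free algebra $W(X)$, $X$ finite and non-empty, have the same number of elements. Let $H\in\Theta$ and let $X$ be a non-empty finite set. For $T\subseteq W(X)\times W(X)$ put $T'=\{\mu: W(X)\to H \mid T\subseteq \mathrm{Ker}\,\mu\}$, and for $A\subseteq \mathrm{Hom}(W(X),H)$ put $A'=\bigcap_{\mu\in A}\mathrm{Ker}\,\mu$ (the full relation if $A=\emptyset$). The sets $T'$ are the algebraic sets, the congruences $A'$ are the $H$-closed congruences, and $\mathrm{Cl}_H(W(X))$ is the set of the latter; $\mathrm{Cl}_H$ is a contravariant functor on $\Theta^0$, acting on morphisms by inverse images of relations. The category $K_\Theta(H)$ has as objects the pairs $(X,A)$ with $A\subseteq\mathrm{Hom}(W(X),H)$ algebraic; the morphisms $(X,A)\to(Y,B)$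 are the maps $[s]:A\to B$, $\nu\mapsto\nu s$, for homomorphisms $s:W(Y)\to W(X)$ with $\nu s\in B$ for all $\nu\in A$. Let $H_1,H_2\in\Theta$, $\Theta_i=\mathrm{Var}(H_i)$, $W^i(X)=W_{\Theta_i}(X)$. The categories $K_\Theta(H_1)$ and $K_\Theta(H_2)$ are called correctly isomorphic if there is an isomorphism of categories $F:K_{\Theta_1}(H_1)\to K_{\Theta_2}(H_2)$ such that 1. for every $X$ there is $Y$ with $|Y|=|X|$ and $F(X,\mathrm{Hom}(W^1(X),H_1))=(Y,\mathrm{Hom}(W^2(Y),H_2))$; 2. $F$ takes every identity embedding $(X,A)\to (X,\mathrm{Hom}(W^1(X),H_1))$ to an identity embedding of algebraic sets (of one affine space). For an isomorphism of categories $\varphi:\Theta_1^0\to\Theta_2^0$, objects $W,W'$ and a relation $T$ on $W'$ let $\tau_{W,W'}(T)$ be the relation on $\mathrm{Hom}(W,W')$ that relates $s$ and $s'$ if and only if $s(w)\,T\,s'(w)$ for all $w\in W$. For a relation $\rho$ on $\mathrm{Hom}(W,W')$ let $\varphi(\rho)$ be its image under $\varphi$. For a relation $T$ on $W$ let $\alpha(\varphi)_W(T)$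 be the relation on $\varphi(W)$ consisting of all pairs $(\mu(w),\mu'(w))$ with $w\in\varphi(W)$ and $\mu,\mu'\in \mathrm{End}(\varphi(W))$ related by $\varphi(\tau_{W,W}(T))$. The algebras $H_1$ and $H_2$ are called geometrically similar if there is an isomorphism $\varphi:\Theta_1^0\to\Theta_2^0$ such that $\alpha(\varphi)$ is compatible with $\tau$, i.e. $\varphi(\tau_{W,W'}(T))=\tau_{\varphi(W),\varphi(W')}(\alpha(\varphi)_{W'}(T))$ for all objects $W,W'$ of $\Theta_1^0$ and all congruences $T$ on $W'$, and such that $\alpha(\varphi)$ is an isomorphism of the functors $\mathrm{Cl}_{H_1}$ and $\mathrm{Cl}_{H_2}\varphi$, i.e. the maps $\alpha(\varphi)_W:\mathrm{Cl}_{H_1}(W)\to\mathrm{Cl}_{H_2}(\varphi(W))$ are well defined, bijective and natural in $W$. Theorem. Let $H_1,H_2$ be algebras in a variety $\Theta$ such that at least one of the varieties $\mathrm{Var}(H_1)$, $\mathrm{Var}(H_2)$ is regular. Then the categories $K_\Theta(H_1)$ and $K_\Theta(H_2)$ are correctly isomorphic if and only if $H_1$ and $H_2$ are geometrically similar. -/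

import Mathlib

namespace UAG

open FirstOrder CategoryTheory

universe u v w w₁ w₂ x

/-! Algebras are `L.Structure`s for a first-order language `L` without relation symbols, and
homomorphisms of algebras are `A →[L] B`. -/

/-- A variety of `L`-algebras, given by a set of identities `p.1 ≡ p.2` in countably many
variables. -/
abbrev Variety (L : FirstOrder.Language.{u, v}) := Set (L.Term ℕ × L.Term ℕ)

section Varieties

variable {L : FirstOrder.Language.{u, v}}

/-- The algebra `A` belongs to the variety `Θ`: all identities of `Θ` hold in `A`. -/
def Variety.Contains (Θ : Variety L) (A : Type w) [L.Structure A] : Prop :=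
  ∀ p ∈ Θ, ∀ a : ℕ → A, p.1.realize a = p.2.realize a

variable (L) in
/-- The variety `Var(H)` generated by the algebra `H`, given by all identities of `H`. -/
def Var (H : Type w) [L.Structure H] : Variety L :=
  {p | ∀ a : ℕ → H, p.1.realize a = p.2.realize a}

variable (L) in
/-- Congruences of the algebra `A`, as binary relations. -/
structure IsCongruence {A : Type w} [L.Structure A] (T : A → A → Prop) : Prop where
  equiv : Equivalence T
  funMap : ∀ (n : ℕ) (f : L.Functions n) (a b : Fin n → A), (∀ i, T (a i) (b i)) →
    T (FirstOrder.Language.Structure.funMap f a) (FirstOrder.Language.Structure.funMap f b)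

/-- The absolutely free algebra of terms. -/
@[reducible]
def termStructure (X : Type x) : L.Structure (L.Term X) where
  funMap f ts := FirstOrder.Language.Term.func f ts
  RelMap _ _ := False

attribute [local instance] termStructure

/-- The least congruence on the algebra of terms in the variables `X` which contains all
substitution instances of the identities of `Θ`. -/
def freeRel (Θ : Variety L) (X : Type x) (t t' : L.Term X) : Prop :=
  ∀ T : L.Term X → L.Term X → Prop, IsCongruence L T →
    (∀ p ∈ Θ, ∀ σ : ℕ → L.Term X, T (p.1.subst σ) (p.2.subst σ)) → T t t'

theorem freeRel_isCongruence (Θ : Variety L) (X : Type x) :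
    IsCongruence L (freeRel Θ X) where
  equiv :=
    { refl := fun t _ hT _ => hT.equiv.refl t
      symm := fun h T hT hΘ => hT.equiv.symm (h T hT hΘ)
      trans := fun h h' T hT hΘ => hT.equiv.trans (h T hT hΘ) (h' T hT hΘ) }
  funMap := fun n f a b h T hT hΘ => hT.funMap n f a b fun i => h i T hT hΘ

def freeSetoid (Θ : Variety L) (X : Type x) : Setoid (L.Term X) :=
  ⟨freeRel Θ X, (freeRel_isCongruence Θ X).equiv⟩

instance (Θ : Variety L) (X : Type x) : L.Prestructure (freeSetoid Θ X) where
  toStructure := termStructure X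
  fun_equiv {n f} a b h := (freeRel_isCongruence Θ X).funMap n f a b h
  rel_equiv _ _ _ := rfl

/-- The free algebra `W(X)` of the variety `Θ` on the set `X`. -/
def Free (Θ : Variety L) (X : Type x) := Quotient (freeSetoid Θ X)

instance (Θ : Variety L) (X : Type x) : L.Structure (Free Θ X) :=
  inferInstanceAs (L.Structure (Quotient (freeSetoid Θ X)))

/-- The element of `W(X)` represented by a term. -/
def Free.mk (Θ : Variety L) {X : Type x} (t : L.Term X) : Free Θ X :=
  Quotient.mk (freeSetoid Θ X) t

/-- The canonical map `X → W(X)`. -/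
def Free.of (Θ : Variety L) {X : Type x} (a : X) : Free Θ X :=
  Free.mk Θ (FirstOrder.Language.Term.var a)

/-- A finite subset `B` of `W(X)` is a system of free generators of `W(X)`: the inclusion of `B`
extends to an isomorphism from the free algebra on `B` onto `W(X)`. -/
def IsFreeGenerators (Θ : Variety L) {X : Type x} (B : Finset (Free Θ X)) : Prop :=
  ∃ e : Free Θ B ≃[L] Free Θ X, ∀ b : B, e (Free.of Θ b) = b

/-- Regular varieties: two (non-empty, finite) systems of free generators of a free algebra
of finite rank always have the same number of elements. -/
def Variety.IsRegular (Θ : Variety L) : Prop :=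
  ∀ (X : Type) [Finite X] [Nonempty X] (B C : Finset (Free Θ X)), B.Nonempty → C.Nonempty →
    IsFreeGenerators Θ B → IsFreeGenerators Θ C → B.card = C.card

end Varieties

section Categories

variable {L : FirstOrder.Language.{u, v}}

/-- Objects of the category `Θ⁰`: the algebras `W(X)` for non-empty finite sets `X`. -/
structure FreeObj (Θ : Variety L) where
  vars : Type
  [finite : Finite vars]
  [nonempty : Nonempty vars]

/-- The algebra `W(X)`. -/
abbrev FreeObj.alg {Θ : Variety L} (X : FreeObj Θ) := Free Θ X.vars

/-- The category `Θ⁰`; morphisms are all homomorphisms. -/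
instance (Θ : Variety L) : Category (FreeObj Θ) where
  Hom X Y := X.alg →[L] Y.alg
  id X := FirstOrder.Language.Hom.id L X.alg
  comp s t := FirstOrder.Language.Hom.comp t s

/-- A morphism of `Θ⁰`, as a homomorphism of algebras. -/
abbrev FreeObj.hom {Θ : Variety L} {X Y : FreeObj Θ} (s : X ⟶ Y) : X.alg →[L] Y.alg := s

variable {Θ : Variety L} {H : Type w} [L.Structure H]

/-- `T'`: the set of points `μ : W(X) → H` which solve the system of equations `T`. -/
def solutions (H : Type w) [L.Structure H] (X : FreeObj Θ) (T : Set (X.alg × X.alg)) :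
    Set (X.alg →[L] H) :=
  {μ | ∀ p ∈ T, μ p.1 = μ p.2}

/-- `A'`: the intersection of the kernels of the points in `A`, as a relation on `W(X)`. -/
def commonKer {X : FreeObj Θ} (A : Set (X.alg →[L] H)) (a b : X.alg) : Prop :=
  ∀ μ ∈ A, μ a = μ b

/-- `Cl_H(W(X))`: the set of all `H`-closed congruences in `W(X)`. -/
def Cl (H : Type w) [L.Structure H] (X : FreeObj Θ) : Set (X.alg → X.alg → Prop) :=
  {T | ∃ A : Set (X.alg →[L] H), T = commonKer A}

/-- The action of `Cl_H` on a morphism `s : W(X) → W(Y)`: the inverse image of a relation. -/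
def pullback {X Y : FreeObj Θ} (s : X ⟶ Y) (T : Y.alg → Y.alg → Prop) (a b : X.alg) : Prop :=
  T (FreeObj.hom s a) (FreeObj.hom s b)

variable (Θ H) in
/-- Objects `(X, A)` of the category `K_Θ(H)`: `A` is an algebraic set in `Hom(W(X), H)`. -/
structure AlgSet where
  space : FreeObj Θ
  points : Set (space.alg →[L] H)
  isAlgebraic : ∃ T, points = solutions H space T

/-- The category `K_Θ(H)`. Morphisms `(X, A) → (Y, B)` are the maps `[s] : A → B`, `ν ↦ ν s`,
induced by homomorphisms `s : W(Y) → W(X)` such that `ν s ∈ B` for all `ν ∈ A`. -/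
instance : Category (AlgSet Θ H) where
  Hom P Q := {f : P.points → Q.points // ∃ s : Q.space.alg →[L] P.space.alg,
    ∀ ν : P.points, (f ν : Q.space.alg →[L] H) = FirstOrder.Language.Hom.comp (ν : P.space.alg →[L] H) s}
  id P := ⟨id, FirstOrder.Language.Hom.id L _, fun _ => rfl⟩
  comp {P Q R} f g := ⟨g.1 ∘ f.1, by
    obtain ⟨s, hs⟩ := f.2
    obtain ⟨t, ht⟩ := g.2
    refine ⟨FirstOrder.Language.Hom.comp s t, fun ν => ?_⟩
    rw [Function.comp_apply, ht, hs]
    rfl⟩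

/-- The whole affine space `Hom(W(X), H)` as an object of `K_Θ(H)`. -/
def AlgSet.affine (H : Type w) [L.Structure H] (X : FreeObj Θ) : AlgSet Θ H where
  space := X
  points := Set.univ
  isAlgebraic := ⟨∅, by simp [solutions]⟩

/-- The identity embedding of algebraic sets `A ⊆ B` in one affine space. -/
def AlgSet.inclusion {X : FreeObj Θ} {A B : Set (X.alg →[L] H)}
    (hA : ∃ T, A = solutions H X T) (hB : ∃ T, B = solutions H X T) (h : A ⊆ B) :
    AlgSet.mk X A hA ⟶ AlgSet.mk X B hB :=
  ⟨Set.inclusion h, FirstOrder.Language.Hom.id L _, fun _ => rfl⟩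

/-- The morphism is an identity embedding; in particular, both of its ends are algebraic sets
in the same affine space. -/
inductive IsIdentityEmbedding : ∀ {P Q : AlgSet Θ H}, (P ⟶ Q) → Prop
  | intro {X : FreeObj Θ} {A B : Set (X.alg →[L] H)}
      (hA : ∃ T, A = solutions H X T) (hB : ∃ T, B = solutions H X T) (h : A ⊆ B) :
      IsIdentityEmbedding (AlgSet.inclusion hA hB h)

end Categories

section Correct

variable {L : FirstOrder.Language.{u, v}} {Θ₁ Θ₂ : Variety L}
  {H₁ : Type w₁} {H₂ : Type w₂} [L.Structure H₁] [L.Structure H₂]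

/-- Correct isomorphisms between categories of algebraic sets. -/
structure IsCorrect (F : IsoCat (AlgSet Θ₁ H₁) (AlgSet Θ₂ H₂)) : Prop where
  affine : ∀ X : FreeObj Θ₁, ∃ Y : FreeObj Θ₂, Nat.card Y.vars = Nat.card X.vars ∧
    F.functor.obj (AlgSet.affine H₁ X) = AlgSet.affine H₂ Y
  embedding : ∀ (X : FreeObj Θ₁) (A : Set (X.alg →[L] H₁)) (hA : ∃ T, A = solutions H₁ X T),
    IsIdentityEmbedding (F.functor.map
      (AlgSet.inclusion hA (AlgSet.affine H₁ X).isAlgebraic (Set.subset_univ A)))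

variable (L H₁ H₂) in
/-- The categories `K_Θ(H₁)` and `K_Θ(H₂)` are correctly isomorphic: there is a correct
isomorphism between `K_{Var(H₁)}(H₁)` and `K_{Var(H₂)}(H₂)`. By this definition the notion is the
same for all varieties `Θ` containing `H₁` and `H₂`. -/
def CorrectlyIsomorphic : Prop :=
  ∃ F : IsoCat (AlgSet (Var L H₁) H₁) (AlgSet (Var L H₂) H₂), IsCorrect F

end Correct

section Similarity

variable {L : FirstOrder.Language.{u, v}} {Θ : Variety L}

/-- `τ_{W,W'}(T)`: the relation on `Hom(W, W')` induced by a relation `T` on `W'`. -/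
def tau (W : FreeObj Θ) {W' : FreeObj Θ} (T : W'.alg → W'.alg → Prop) (s s' : W ⟶ W') : Prop :=
  ∀ a : W.alg, T (FreeObj.hom s a) (FreeObj.hom s' a)

/-- `γ_W(ρ)`: the relation on `W` induced by a relation `ρ` on `End(W)`. -/
def gamma {W : FreeObj Θ} (ρ : (W ⟶ W) → (W ⟶ W) → Prop) (a b : W.alg) : Prop :=
  ∃ (c : W.alg) (ν ν' : W ⟶ W),
    FreeObj.hom ν c = a ∧ FreeObj.hom ν' c = b ∧ ρ ν ν'

variable {Θ₁ Θ₂ : Variety L}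

/-- `φ(ρ)`: the image under the functor `φ` of a relation `ρ` on `Hom(V, W)`. -/
def mapRel (φ : FreeObj Θ₁ ⥤ FreeObj Θ₂) {V W : FreeObj Θ₁} (ρ : (V ⟶ W) → (V ⟶ W) → Prop) :
    (φ.obj V ⟶ φ.obj W) → (φ.obj V ⟶ φ.obj W) → Prop :=
  Relation.Map ρ φ.map φ.map

/-- `α(φ)_W(T) = γ_{φ(W)}(φ(τ_{W,W}(T)))`: the action of `φ` on the relations on `W`. -/
def alpha (φ : FreeObj Θ₁ ⥤ FreeObj Θ₂) (W : FreeObj Θ₁) (T : W.alg → W.alg → Prop) :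
    (φ.obj W).alg → (φ.obj W).alg → Prop :=
  gamma (mapRel φ (tau W T))

/-- The function `α(φ)` is compatible with the function `τ`. -/
def TauCompatible (φ : FreeObj Θ₁ ⥤ FreeObj Θ₂) : Prop :=
  ∀ (W W' : FreeObj Θ₁) (T : W'.alg → W'.alg → Prop), IsCongruence L T →
    mapRel φ (tau W T) = tau (φ.obj W) (alpha φ W' T)

/-- `α(φ)` is an isomorphism of the functors `Cl_{H₁}` and `Cl_{H₂} φ`: its components are
bijections and it is natural. -/
structure IsClIso (H₁ : Type w₁) (H₂ : Type w₂) [L.Structure H₁] [L.Structure H₂]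
    (φ : FreeObj Θ₁ ⥤ FreeObj Θ₂) : Prop where
  bijOn : ∀ W : FreeObj Θ₁, Set.BijOn (alpha φ W) (Cl H₁ W) (Cl H₂ (φ.obj W))
  natural : ∀ {W W' : FreeObj Θ₁} (s : W ⟶ W'), ∀ T ∈ Cl H₁ W',
    alpha φ W (pullback s T) = pullback (φ.map s) (alpha φ W' T)

variable (L) in
/-- Geometric similarity of the algebras `H₁` and `H₂`. -/
def GeometricallySimilar (H₁ : Type w₁) (H₂ : Type w₂) [L.Structure H₁] [L.Structure H₂] : Prop :=
  ∃ φ : IsoCat (FreeObj (Var L H₁)) (FreeObj (Var L H₂)),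
    TauCompatible φ.functor ∧ IsClIso H₁ H₂ φ.functor

end Similarity

end UAG

/-!
Over `Var(H)` the algebra `H` separates the elements of every free algebra of finite rank
(`Free.eq_of_forall_hom`), so a homomorphism `s : W(Y) → W(X)` is determined by the map `[s]` which
it induces on `Hom(W(X), H)`. Hence the affine spaces form a full subcategory of `K(H)` which is
opposite to the category of free algebras. An algebraic set `A` is the same thing as its closed
congruence `A'`, and in terms of congruences the category `K(H)` is read off from free algebras:
`s` induces a map `A → B` if and only if `B' ≤ s⁻¹(A')`, and `[s] = [s']` on `A` if and only if
`τ(A')` relates `s` and `s'`.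

From similarity to correct isomorphism: an isomorphism `φ` with `α(φ)` compatible with `τ` and an
isomorphism of the functors `Cl` carries this description of `K(H₁)` to that of `K(H₂)`, so that
`(X, A) ↦ (φ(X), α(φ)(A')')`, `[s] ↦ [φ(s)]` is an isomorphism of categories
(`algSetFunctor_isIso`). It preserves ranks by regularity: `φ` preserves copowers, hence multiplies
ranks by some `k`, its inverse multiplies them by some `m`, and comparing the ranks of isomorphic
free algebras gives `k * m = 1` (`card_vars_obj`). This argument needs the generators of free
algebras to be distinct. It fails for the trivial variety, which is regular because a one-element
algebra has only one non-empty set of generators; there the categories of algebraic sets are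
indiscrete and are matched by hand (`correctlyIsomorphic_of_subsingleton`).

From correct isomorphism to similarity: `F` maps affine spaces onto affine spaces, which yields the
functor `φ` (`affineFunctor`). The embedding of an algebraic set `A` into its affine space goes to
an identity embedding; let `β(A')` be the closed congruence of its image. That two maps `[s]`, `[s']`
agree on `A`, or that `[s]` maps `A` into `B`, is a statement about composition with these
embeddings, so `F` preserves it. The first kind of statement gives `α(φ) = β` on closed congruences
(`alpha_affineFunctor`), the second gives naturality. Compatibility with `τ` for congruences which
need not be closed holds for every fully faithful functor (`tauCompatible_of_fullyFaithful`): the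
preimages of the constant endomorphisms at the generators of `φ(W)` have images generating `W`.
-/

namespace UAG

open FirstOrder CategoryTheory

universe u v w w₁ w₂ x

/-! ### Free algebras of a variety -/

section FreeAlgebras

variable {L : FirstOrder.Language.{u, v}} {Θ : Variety L}

theorem Free.funMap_mk {X : Type x} {n : ℕ} (f : L.Functions n) (t : Fin n → L.Term X) :
    FirstOrder.Language.Structure.funMap f (fun i => Free.mk Θ (t i)) =
      Free.mk Θ (FirstOrder.Language.Term.func f t) :=
  FirstOrder.Language.funMap_quotient_mk' (freeSetoid Θ X) f t

theorem Free.exists_mk {X : Type x} (a : Free Θ X) : ∃ t, Free.mk Θ t = a :=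
  Quotient.exists_rep a

theorem Free.mk_eq_mk {X : Type x} {t t' : L.Term X} :
    Free.mk Θ t = Free.mk Θ t' ↔ freeRel Θ X t t' :=
  Quotient.eq (r := freeSetoid Θ X)

theorem Free.realize_mk {X : Type x} (t : L.Term ℕ) (σ : ℕ → L.Term X) :
    t.realize (fun i => Free.mk Θ (σ i)) = Free.mk Θ (t.subst σ) := by
  induction t with
  | var => rfl
  | func f ts ih =>
    simp only [FirstOrder.Language.Term.realize, ih, Free.funMap_mk]
    rfl

theorem Free.contains (X : Type x) : Θ.Contains (Free Θ X) := by
  intro p hp a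
  choose σ hσ using fun i => Free.exists_mk (a i)
  obtain rfl : (fun i => Free.mk Θ (σ i)) = a := funext hσ
  rw [Free.realize_mk, Free.realize_mk, Free.mk_eq_mk]
  exact fun T _ hT => hT p hp σ

theorem freeRel.realize_eq {A : Type w} [L.Structure A] (hA : Θ.Contains A) {X : Type x}
    {t t' : L.Term X} (h : freeRel Θ X t t') (f : X → A) : t.realize f = t'.realize f := by
  let _ := termStructure (L := L) X
  refine h (fun s s' => s.realize f = s'.realize f) ⟨⟨fun _ => rfl, Eq.symm, Eq.trans⟩, ?_⟩ ?_
  · intro n g a b hab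
    exact congrArg (FirstOrder.Language.Structure.funMap g) (funext hab)
  · intro p hp σ
    simp only [FirstOrder.Language.Term.realize_subst]
    exact hA p hp _

/-- The universal property of the free algebra: the homomorphism into an algebra of the variety
which extends a given map on the generators. -/
def Free.lift [L.IsAlgebraic] {A : Type w} [L.Structure A] (hA : Θ.Contains A) {X : Type x}
    (f : X → A) : Free Θ X →[L] A where
  toFun := Quotient.lift (fun t : L.Term X => t.realize f) fun _ _ h => freeRel.realize_eq hA h f
  map_fun' {n} g a := by
    choose t ht using fun i => Free.exists_mk (a i)
    obtain rfl : (fun i => Free.mk Θ (t i)) = a := funext ht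
    rw [Free.funMap_mk]
    rfl
  map_rel' r := isEmptyElim r

@[simp]
theorem Free.lift_mk [L.IsAlgebraic] {A : Type w} [L.Structure A] (hA : Θ.Contains A) {X : Type x}
    (f : X → A) (t : L.Term X) : Free.lift hA f (Free.mk Θ t) = t.realize f := rfl

@[simp]
theorem Free.lift_of [L.IsAlgebraic] {A : Type w} [L.Structure A] (hA : Θ.Contains A) {X : Type x}
    (f : X → A) (i : X) : Free.lift hA f (Free.of Θ i) = f i := rfl

/-- Two homomorphisms out of a free algebra are congruent pointwise as soon as they are congruent
on the generators. -/
theorem Free.rel_of_rel_of {A : Type w} [L.Structure A] {T : A → A → Prop}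
    (hT : IsCongruence L T) {X : Type x} {s s' : Free Θ X →[L] A}
    (h : ∀ i, T (s (Free.of Θ i)) (s' (Free.of Θ i))) (a : Free Θ X) : T (s a) (s' a) := by
  obtain ⟨t, rfl⟩ := Free.exists_mk a
  induction t with
  | var i => exact h i
  | func f ts ih =>
    rw [← Free.funMap_mk, s.map_fun, s'.map_fun]
    exact hT.funMap _ f _ _ ih

theorem isCongruence_eq (A : Type w) [L.Structure A] : IsCongruence L (Eq : A → A → Prop) :=
  ⟨eq_equivalence, fun _ _ _ _ h => congrArg _ (funext h)⟩

theorem Free.hom_ext {A : Type w} [L.Structure A] {X : Type x} {s s' : Free Θ X →[L] A}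
    (h : ∀ i, s (Free.of Θ i) = s' (Free.of Θ i)) : s = s' :=
  FirstOrder.Language.Hom.ext (Free.rel_of_rel_of (isCongruence_eq A) h)

theorem Var.contains (H : Type w) [L.Structure H] : (Var L H).Contains H := fun _ hp => hp

/-- The free algebras of `Var(H)` of finite rank are separated by their homomorphisms to `H`. -/
theorem Free.eq_of_forall_hom [L.IsAlgebraic] {H : Type w} [L.Structure H] {X : Type x} [Finite X]
    [Nonempty X] {a b : Free (Var L H) X} (h : ∀ μ : Free (Var L H) X →[L] H, μ a = μ b) :
    a = b := by
  obtain ⟨t, rfl⟩ := Free.exists_mk a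
  obtain ⟨t', rfl⟩ := Free.exists_mk b
  obtain ⟨e, he⟩ := Countable.exists_injective_nat X
  -- Renaming the variables injectively to natural numbers gives an identity of `H`.
  have hmem : (t.relabel e, t'.relabel e) ∈ Var L H := by
    intro f
    simpa using h (Free.lift (Var.contains H) (f ∘ e))
  have hsub : ∀ s : L.Term X,
      (s.relabel e).subst (fun n => FirstOrder.Language.Term.var (Function.invFun e n)) = s := by
    intro s
    induction s with
    | var i =>
      exact congrArg FirstOrder.Language.Term.var (Function.leftInverse_invFun he i)
    | func f ts ih =>
      exact congrArg (FirstOrder.Language.Term.func f) (funext ih)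
  rw [Free.mk_eq_mk]
  intro T _ hT
  have := hT _ hmem fun n => FirstOrder.Language.Term.var (Function.invFun e n)
  rwa [hsub, hsub] at this

/-- In a variety where two different generators of some free algebra coincide, all free algebras
have at most one element. -/
theorem Free.subsingleton_of_not_injective [L.IsAlgebraic] {X : Type x}
    (h : ¬ Function.Injective (Free.of Θ : X → Free Θ X)) {A : Type w} [L.Structure A]
    (hA : Θ.Contains A) : Subsingleton A := by
  classical
  simp only [Function.Injective, not_forall] at h
  obtain ⟨i, j, hij, hne⟩ := h
  refine ⟨fun a b => ?_⟩
  have := congrArg (Free.lift hA fun k => if k = i then a else b) hij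
  simpa [Ne.symm hne] using this

/-- Bijections of the generators induce isomorphisms of free algebras. -/
def Free.equivOfEquiv [L.IsAlgebraic] {X Y : Type*} (e : X ≃ Y) :
    Free Θ X ≃[L] Free Θ Y where
  toFun := Free.lift (Free.contains Y) fun i => Free.of Θ (e i)
  invFun := Free.lift (Free.contains X) fun i => Free.of Θ (e.symm i)
  left_inv := by
    refine fun a => DFunLike.congr_fun (Free.hom_ext (s := (Free.lift (Free.contains X) fun i =>
      Free.of Θ (e.symm i)).comp (Free.lift (Free.contains Y) fun i => Free.of Θ (e i)))
      (s' := FirstOrder.Language.Hom.id L _) fun i => ?_) a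
    simp
  right_inv := by
    refine fun a => DFunLike.congr_fun (Free.hom_ext (s := (Free.lift (Free.contains Y) fun i =>
      Free.of Θ (e i)).comp (Free.lift (Free.contains X) fun i => Free.of Θ (e.symm i)))
      (s' := FirstOrder.Language.Hom.id L _) fun i => ?_) a
    simp
  map_fun' f a := FirstOrder.Language.Hom.map_fun _ f a
  map_rel' r := isEmptyElim r

/-- In a regular variety with injective generator maps, the rank of a free algebra of finite rank
is an invariant of the algebra. -/
theorem Variety.IsRegular.card_eq [L.IsAlgebraic] (hΘ : Θ.IsRegular)
    (hinj : ∀ Z : Type, Function.Injective (Free.of Θ : Z → Free Θ Z))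
    {X Y : Type} [Finite X] [Finite Y] [Nonempty X] [Nonempty Y] (e : Free Θ X ≃[L] Free Θ Y) :
    Nat.card X = Nat.card Y := by
  classical
  have := Fintype.ofFinite X
  have := Fintype.ofFinite Y
  -- An isomorphic image of the standard free generators is a system of free generators.
  have key : ∀ (Z : Type) [Fintype Z] (e : Free Θ Z ≃[L] Free Θ Y),
      ∃ B : Finset (Free Θ Y), B.card = Nat.card Z ∧ IsFreeGenerators Θ B := by
    intro Z _ e
    have hg : Function.Injective fun z : Z => e (Free.of Θ z) := e.injective.comp (hinj Z)
    refine ⟨Finset.univ.map ⟨_, hg⟩, by simp, ?_⟩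
    have hb : Function.Bijective (fun z : Z => (⟨e (Free.of Θ z), by simp⟩ :
        (Finset.univ.map ⟨fun z : Z => e (Free.of Θ z), hg⟩ : Finset (Free Θ Y)))) := by
      refine ⟨fun z z' h => hg (congrArg Subtype.val h), fun ⟨b, hb⟩ => ?_⟩
      obtain ⟨z, -, rfl⟩ := Finset.mem_map.1 hb
      exact ⟨z, rfl⟩
    refine ⟨e.comp (Free.equivOfEquiv (Equiv.ofBijective _ hb).symm), fun b => ?_⟩
    obtain ⟨z, rfl⟩ := hb.2 b
    change e (Free.of Θ ((Equiv.ofBijective _ hb).symm _)) = _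
    exact congrArg (fun z => e (Free.of Θ z)) (Equiv.ofBijective_symm_apply_apply _ hb z)
  obtain ⟨B, hB, hB'⟩ := key X e
  obtain ⟨C, hC, hC'⟩ := key Y (FirstOrder.Language.Equiv.refl L _)
  have := hΘ Y B C (Finset.card_pos.1 (hB ▸ Nat.card_pos)) (Finset.card_pos.1 (hC ▸ Nat.card_pos))
    hB' hC'
  rw [← hB, ← hC, this]

end FreeAlgebras

/-! ### Relations on morphisms of free algebras -/

section FreeObjects

variable {L : FirstOrder.Language.{u, v}} {Θ Θ₁ Θ₂ : Variety L}

attribute [instance] FreeObj.finite FreeObj.nonempty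

theorem FreeObj.hom_ext {X Y : FreeObj Θ} {s s' : X ⟶ Y}
    (h : ∀ i, FreeObj.hom s (Free.of Θ i) = FreeObj.hom s' (Free.of Θ i)) : s = s' :=
  Free.hom_ext h

/-- Isomorphic objects of `Θ⁰` have isomorphic algebras. -/
def FreeObj.algEquiv [L.IsAlgebraic] {X Y : FreeObj Θ} (e : X ≅ Y) : X.alg ≃[L] Y.alg where
  toFun := FreeObj.hom e.hom
  invFun := FreeObj.hom e.inv
  left_inv a := congrArg (fun s : X ⟶ X => FreeObj.hom s a) e.hom_inv_id
  right_inv a := congrArg (fun s : Y ⟶ Y => FreeObj.hom s a) e.inv_hom_id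
  map_fun' f a := FirstOrder.Language.Hom.map_fun _ f a
  map_rel' r := isEmptyElim r

variable [L.IsAlgebraic]

/-- The morphism of `Θ⁰` with given values on the generators. -/
def FreeObj.lift {X Y : FreeObj Θ} (f : X.vars → Y.alg) : X ⟶ Y :=
  Free.lift (Free.contains Y.vars) f

/-- The morphism of `Θ⁰` which sends all generators to one element `a`. -/
def FreeObj.const (X : FreeObj Θ) {Y : FreeObj Θ} (a : Y.alg) : X ⟶ Y :=
  FreeObj.lift fun _ => a

@[simp]
theorem FreeObj.const_of (X : FreeObj Θ) {Y : FreeObj Θ} (a : Y.alg) (i : X.vars) :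
    FreeObj.hom (FreeObj.const X a) (Free.of Θ i) = a := rfl

theorem FreeObj.const_comp (X : FreeObj Θ) {Y Z : FreeObj Θ} (a : Y.alg) (s : Y ⟶ Z) :
    FreeObj.const X a ≫ s = FreeObj.const X (FreeObj.hom s a) :=
  FreeObj.hom_ext fun _ => rfl

omit [L.IsAlgebraic] in
theorem tau_comp {W V W' : FreeObj Θ} {T : W'.alg → W'.alg → Prop} (f : V ⟶ W) {s s' : W ⟶ W'}
    (h : tau W T s s') : tau V T (f ≫ s) (f ≫ s') := fun _ => h _

theorem tau_const_iff {W W' : FreeObj Θ} {T : W'.alg → W'.alg → Prop} (hT : IsCongruence L T)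
    {a b : W'.alg} : tau W T (FreeObj.const W a) (FreeObj.const W b) ↔ T a b :=
  ⟨fun h => h (Free.of Θ (Classical.arbitrary _)), fun h => Free.rel_of_rel_of hT fun _ => h⟩

omit [L.IsAlgebraic] in
theorem mapRel_map_iff (φ : FreeObj Θ₁ ⥤ FreeObj Θ₂) [φ.Faithful] {V W : FreeObj Θ₁}
    {ρ : (V ⟶ W) → (V ⟶ W) → Prop} {s s' : V ⟶ W} :
    mapRel φ ρ (φ.map s) (φ.map s') ↔ ρ s s' := by
  refine ⟨?_, fun h => ⟨s, s', h, rfl, rfl⟩⟩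
  rintro ⟨r, r', h, hr, hr'⟩
  rwa [← φ.map_injective hr, ← φ.map_injective hr']

/-- The preimages under a fully faithful functor of the constant endomorphisms at the generators of
`φ(W)` have images which together generate `W`: morphisms out of `W` are congruent as soon as their
composites with these endomorphisms are. -/
theorem tau_of_tau_preimage_const (φ : FreeObj Θ₁ ⥤ FreeObj Θ₂) [φ.Full] [φ.Faithful]
    {W W' : FreeObj Θ₁} {T : W'.alg → W'.alg → Prop} (hT : IsCongruence L T) {s s' : W ⟶ W'}
    (h : ∀ y : (φ.obj W).vars,
      tau W T (φ.preimage (FreeObj.const (φ.obj W) (Free.of Θ₂ y) : φ.obj W ⟶ φ.obj W) ≫ s)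
        (φ.preimage (FreeObj.const (φ.obj W) (Free.of Θ₂ y) : φ.obj W ⟶ φ.obj W) ≫ s')) :
    tau W T s s' := by
  set c : (φ.obj W).vars → (W ⟶ W) := fun y =>
    φ.preimage (FreeObj.const (φ.obj W) (Free.of Θ₂ y)) with hc
  -- The endomorphisms `c y` together form a morphism `p` from a copower of `W` to `W`; `φ(p)` is
  -- a split epimorphism because the constants hit all generators of `φ(W)`.
  let C : FreeObj Θ₁ := ⟨(φ.obj W).vars × W.vars⟩
  let j : (φ.obj W).vars → (W ⟶ C) := fun y => FreeObj.lift fun i => Free.of Θ₁ (y, i)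
  let p : C ⟶ W := FreeObj.lift fun q => FreeObj.hom (c q.1) (Free.of Θ₁ q.2)
  have hjp : ∀ y, j y ≫ p = c y := fun y => FreeObj.hom_ext fun i => rfl
  let q : φ.obj W ⟶ φ.obj C :=
    FreeObj.lift fun y => FreeObj.hom (φ.map (j y)) (Free.of Θ₂ y)
  have hqp : q ≫ φ.map p = 𝟙 _ := by
    refine FreeObj.hom_ext fun y => ?_
    change FreeObj.hom (φ.map (j y) ≫ φ.map p) (Free.of Θ₂ y) = Free.of Θ₂ y
    rw [← φ.map_comp, hjp, hc, φ.map_preimage, FreeObj.const_of]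
  have hsplit : φ.preimage q ≫ p = 𝟙 W := φ.map_injective (by simp [hqp])
  have hC : tau C T (p ≫ s) (p ≫ s') := Free.rel_of_rel_of hT fun r => h r.1 (Free.of Θ₁ r.2)
  have := tau_comp (φ.preimage q) hC
  rwa [← Category.assoc, ← Category.assoc, hsplit, Category.id_comp, Category.id_comp] at this

/-- For a fully faithful functor the function `α(φ)` is always compatible with `τ`. -/
theorem tauCompatible_of_fullyFaithful (φ : FreeObj Θ₁ ⥤ FreeObj Θ₂) [φ.Full] [φ.Faithful] :
    TauCompatible φ := by
  intro W W' T hT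
  ext t t'
  constructor
  · rintro ⟨s, s', h, rfl, rfl⟩ a
    refine ⟨Free.of Θ₂ (Classical.arbitrary _), φ.map (φ.preimage (FreeObj.const _ a) ≫ s),
      φ.map (φ.preimage (FreeObj.const _ a) ≫ s'), ?_, ?_,
      (mapRel_map_iff φ).2 (tau_comp _ h)⟩
    all_goals
      rw [φ.map_comp, φ.map_preimage, FreeObj.const_comp, FreeObj.const_of]
  · intro h
    obtain ⟨s, rfl⟩ := φ.map_surjective t
    obtain ⟨s', rfl⟩ := φ.map_surjective t'
    rw [mapRel_map_iff]
    refine tau_of_tau_preimage_const φ hT fun y => ?_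
    obtain ⟨d, _, _, hd, hd', r, r', hr, rfl, rfl⟩ := h (Free.of Θ₂ y)
    -- Elements of `φ(W)` and `φ(W')` are replaced by constant morphisms, which `φ⁻¹` can move.
    have key : ∀ {r : W' ⟶ W'} {s : W ⟶ W'},
        FreeObj.hom (φ.map r) d = FreeObj.hom (φ.map s) (Free.of Θ₂ y) →
        φ.preimage (FreeObj.const (φ.obj W) (Free.of Θ₂ y)) ≫ s =
          φ.preimage (FreeObj.const (φ.obj W) d) ≫ r := by
      intro r s hrs
      apply φ.map_injective
      simp only [φ.map_comp, φ.map_preimage, FreeObj.const_comp, hrs]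
    rw [key hd, key hd']
    exact tau_comp _ hr

omit [L.IsAlgebraic] in
theorem alpha_mono (φ : FreeObj Θ₁ ⥤ FreeObj Θ₂) {W : FreeObj Θ₁}
    {T S : W.alg → W.alg → Prop} (h : T ≤ S) : alpha φ W T ≤ alpha φ W S := by
  rintro _ _ ⟨c, _, _, rfl, rfl, r, r', hr, rfl, rfl⟩
  exact ⟨c, _, _, rfl, rfl, r, r', fun a => h _ _ (hr a), rfl, rfl⟩

omit [L.IsAlgebraic] in
theorem alpha_eq_imp_eq (φ : FreeObj Θ₁ ⥤ FreeObj Θ₂) {W : FreeObj Θ₁} {T : W.alg → W.alg → Prop}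
    (hT : ∀ a b, T a b → a = b) {a b : (φ.obj W).alg} (h : alpha φ W T a b) : a = b := by
  obtain ⟨c, _, _, rfl, rfl, r, r', hr, rfl, rfl⟩ := h
  rw [show r = r' from FirstOrder.Language.Hom.ext fun d => hT _ _ (hr d)]

omit [L.IsAlgebraic] in
theorem TauCompatible.tau_iff {φ : FreeObj Θ₁ ⥤ FreeObj Θ₂} (hφ : TauCompatible φ) [φ.Faithful]
    {W W' : FreeObj Θ₁} {T : W'.alg → W'.alg → Prop} (hT : IsCongruence L T) {s s' : W ⟶ W'} :
    tau (φ.obj W) (alpha φ W' T) (φ.map s) (φ.map s') ↔ tau W T s s' := by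
  rw [← hφ W W' T hT, mapRel_map_iff]

theorem TauCompatible.alpha_le_iff {φ : FreeObj Θ₁ ⥤ FreeObj Θ₂} (hφ : TauCompatible φ) [φ.Faithful]
    {W : FreeObj Θ₁} {T S : W.alg → W.alg → Prop} (hT : IsCongruence L T) (hS : IsCongruence L S) :
    alpha φ W T ≤ alpha φ W S ↔ T ≤ S := by
  refine ⟨fun h a b hab => ?_, alpha_mono φ⟩
  rw [← tau_const_iff (W := W) hT, ← hφ.tau_iff hT] at hab
  rw [← tau_const_iff (W := W) hS, ← hφ.tau_iff hS]
  exact fun c => h _ _ (hab c)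

end FreeObjects

/-! ### Ranks of free algebras -/

section Rank

variable {L : FirstOrder.Language.{u, v}} [L.IsAlgebraic] {Θ₁ Θ₂ : Variety L}

/-- An equivalence onto all objects multiplies ranks by the rank of the image of the free algebra
on one generator, because it preserves copowers. -/
theorem nonempty_obj_iso_prod (φ : FreeObj Θ₁ ⥤ FreeObj Θ₂) [φ.Full] [φ.Faithful]
    (hφ : Function.Surjective φ.obj) (X : FreeObj Θ₁) :
    Nonempty (φ.obj X ≅ (⟨X.vars × (φ.obj ⟨Unit⟩).vars⟩ : FreeObj Θ₂)) := by
  obtain ⟨Z, hZ⟩ := hφ ⟨X.vars × (φ.obj ⟨Unit⟩).vars⟩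
  suffices ∀ Y : FreeObj Θ₂, Y = ⟨X.vars × (φ.obj ⟨Unit⟩).vars⟩ → φ.obj Z = Y →
      Nonempty (φ.obj X ≅ Y) from this _ rfl hZ
  rintro Y hY rfl
  -- The copower injections into `φ(X)` and into the free algebra on the product.
  let ι : X.vars → ((⟨Unit⟩ : FreeObj Θ₁) ⟶ X) := fun i => FreeObj.const _ (Free.of Θ₁ i)
  obtain ⟨k, q, hq, hk⟩ : ∃ (k : X.vars → (φ.obj ⟨Unit⟩ ⟶ φ.obj Z)) (q : φ.obj Z ⟶ φ.obj X),
      (∀ i, k i ≫ q = φ.map (ι i)) ∧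
      ∀ {V : FreeObj Θ₂} (f g : φ.obj Z ⟶ V), (∀ i, k i ≫ f = k i ≫ g) → f = g := by
    rw [hY]
    refine ⟨fun i => FreeObj.lift fun j => Free.of Θ₂ (i, j),
      FreeObj.lift fun r => FreeObj.hom (φ.map (ι r.1)) (Free.of Θ₂ r.2), ?_, ?_⟩
    · exact fun i => FreeObj.hom_ext fun j => rfl
    · exact fun f g h => FreeObj.hom_ext fun r =>
        congrArg (fun s => FreeObj.hom s (Free.of Θ₂ r.2)) (h r.1)
  let p : X ⟶ Z := FreeObj.lift fun i => FreeObj.hom (φ.preimage (k i)) (Free.of Θ₁ ())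
  have hp : ∀ i, φ.map (ι i) ≫ φ.map p = k i := by
    intro i
    rw [← φ.map_comp, show ι i ≫ p = φ.preimage (k i) from FreeObj.hom_ext fun _ => rfl,
      φ.map_preimage]
  refine ⟨⟨φ.map p, q, ?_, hk _ _ fun i => ?_⟩⟩
  · have : p ≫ φ.preimage q = 𝟙 X := by
      refine FreeObj.hom_ext fun i => ?_
      refine congrArg (fun s => FreeObj.hom s (Free.of Θ₁ ()))
        (show ι i ≫ p ≫ φ.preimage q = ι i from φ.map_injective ?_)
      rw [φ.map_comp, φ.map_comp, φ.map_preimage, ← Category.assoc, hp, hq]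
    rw [← φ.map_preimage q, ← φ.map_comp, this, φ.map_id]
  · rw [← Category.assoc, hq, hp, Category.comp_id]

/-- An isomorphism onto the category of a non-trivial regular variety preserves ranks. -/
theorem card_vars_obj (φ : IsoCat (FreeObj Θ₁) (FreeObj Θ₂)) (hΘ : Θ₂.IsRegular)
    (hinj : ∀ Z : Type, Function.Injective (Free.of Θ₂ : Z → Free Θ₂ Z)) (X : FreeObj Θ₁) :
    Nat.card (φ.functor.obj X).vars = Nat.card X.vars := by
  have card_eq : ∀ {Y Z : FreeObj Θ₂}, Nonempty (Y ≅ Z) → Nat.card Y.vars = Nat.card Z.vars :=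
    fun ⟨e⟩ => hΘ.card_eq hinj (FreeObj.algEquiv e)
  have h₁ := nonempty_obj_iso_prod φ.functor φ.functor.bijective_obj.2
  have h₂ := nonempty_obj_iso_prod φ.inverse φ.inverse.bijective_obj.2
  have hone : φ.functor.obj (φ.inverse.obj ⟨Unit⟩) = ⟨Unit⟩ :=
    Functor.congr_obj φ.counit_eq ⟨Unit⟩
  obtain ⟨e⟩ := h₂ ⟨Unit⟩
  obtain ⟨e'⟩ := h₁ ⟨Unit × (φ.inverse.obj ⟨Unit⟩).vars⟩
  have key := card_eq ⟨φ.functor.mapIso e ≪≫ e'⟩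
  -- With `k` and `m` the ranks of the images of `W(1)` under `φ` and its inverse: `1 = m * k`.
  rw [hone] at key
  simp only [Nat.card_prod, Nat.card_unique, one_mul] at key
  rw [card_eq (h₁ X), Nat.card_prod, Nat.eq_one_of_mul_eq_one_left key.symm, mul_one]

end Rank

/-! ### Algebraic sets and closed congruences -/

section Galois

variable {L : FirstOrder.Language.{u, v}} {Θ : Variety L} {H : Type w} [L.Structure H]

theorem commonKer_isCongruence {X : FreeObj Θ} (A : Set (X.alg →[L] H)) :
    IsCongruence L (commonKer A) where
  equiv := ⟨fun _ _ _ => rfl, fun h μ hμ => (h μ hμ).symm,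
    fun h h' μ hμ => (h μ hμ).trans (h' μ hμ)⟩
  funMap n f a b h μ hμ := by
    rw [μ.map_fun, μ.map_fun]
    exact congrArg _ (funext fun i => h i μ hμ)

theorem isCongruence_of_mem_Cl {X : FreeObj Θ} {T : X.alg → X.alg → Prop} (hT : T ∈ Cl H X) :
    IsCongruence L T := by
  obtain ⟨A, rfl⟩ := hT
  exact commonKer_isCongruence A

theorem commonKer_mem_Cl {X : FreeObj Θ} (A : Set (X.alg →[L] H)) : commonKer A ∈ Cl H X :=
  ⟨A, rfl⟩

theorem pullback_mem_Cl {X Y : FreeObj Θ} (s : X ⟶ Y) {T : Y.alg → Y.alg → Prop}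
    (hT : T ∈ Cl H Y) : pullback s T ∈ Cl H X := by
  obtain ⟨A, rfl⟩ := hT
  refine ⟨(fun ν => ν.comp (FreeObj.hom s)) '' A, ?_⟩
  ext a b
  simp [pullback, commonKer]

/-- The algebraic set `T'` of a relation `T` on `W(X)`, as an object of `K_Θ(H)`. -/
def AlgSet.zeros (H : Type w) [L.Structure H] (X : FreeObj Θ) (T : X.alg → X.alg → Prop) :
    AlgSet Θ H where
  space := X
  points := solutions H X {p | T p.1 p.2}
  isAlgebraic := ⟨_, rfl⟩

theorem AlgSet.mem_zeros {X : FreeObj Θ} {T : X.alg → X.alg → Prop} {μ : X.alg →[L] H} :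
    μ ∈ (AlgSet.zeros H X T).points ↔ ∀ a b, T a b → μ a = μ b :=
  ⟨fun h a b hab => h (a, b) hab, fun h p hp => h p.1 p.2 hp⟩

/-- The closed congruence `A'` of an algebraic set. -/
def AlgSet.cong (P : AlgSet Θ H) : P.space.alg → P.space.alg → Prop := commonKer P.points

theorem AlgSet.cong_mem_Cl (P : AlgSet Θ H) : P.cong ∈ Cl H P.space := ⟨_, rfl⟩

theorem AlgSet.cong_isCongruence (P : AlgSet Θ H) : IsCongruence L P.cong :=
  commonKer_isCongruence _

theorem AlgSet.cong_zeros {X : FreeObj Θ} {T : X.alg → X.alg → Prop} (hT : T ∈ Cl H X) :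
    (AlgSet.zeros H X T).cong = T := by
  obtain ⟨A, rfl⟩ := hT
  ext a b
  exact ⟨fun h μ hμ => h μ (AlgSet.mem_zeros.2 fun a b hab => hab μ hμ),
    fun h μ hμ => AlgSet.mem_zeros.1 hμ a b h⟩

theorem AlgSet.mem_points_iff (P : AlgSet Θ H) {μ : P.space.alg →[L] H} :
    μ ∈ P.points ↔ ∀ a b, P.cong a b → μ a = μ b := by
  refine ⟨fun h a b hab => hab μ h, fun h => ?_⟩
  obtain ⟨T, hT⟩ := P.isAlgebraic
  rw [hT]
  intro p hp
  refine h _ _ fun ν hν => ?_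
  rw [hT] at hν
  exact hν p hp

theorem AlgSet.zeros_cong (P : AlgSet Θ H) : AlgSet.zeros H P.space P.cong = P := by
  have : (AlgSet.zeros H P.space P.cong).points = P.points :=
    Set.ext fun μ => AlgSet.mem_zeros.trans P.mem_points_iff.symm
  obtain ⟨X, A, hA⟩ := P
  change AlgSet.mk X _ _ = _
  congr

/-- An algebraic set is determined by its affine space and its closed congruence. -/
theorem AlgSet.mk_eq_mk_of_commonKer_eq {X : FreeObj Θ} {A B : Set (X.alg →[L] H)}
    {hA : ∃ T, A = solutions H X T} {hB : ∃ T, B = solutions H X T}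
    (h : commonKer A = commonKer B) : AlgSet.mk X A hA = AlgSet.mk X B hB := by
  have hA' := AlgSet.zeros_cong (AlgSet.mk X A hA)
  have hB' := AlgSet.zeros_cong (AlgSet.mk X B hB)
  rw [← hA', ← hB']
  change AlgSet.zeros H X (commonKer A) = AlgSet.zeros H X (commonKer B)
  rw [h]

/-- The condition for `s` to induce a map of algebraic sets, in terms of closed congruences. -/
theorem AlgSet.forall_comp_mem_iff {X : FreeObj Θ} (A : Set (X.alg →[L] H)) (Q : AlgSet Θ H)
    (s : Q.space ⟶ X) :
    (∀ ν ∈ A, ν.comp (FreeObj.hom s) ∈ Q.points) ↔ Q.cong ≤ pullback s (commonKer A) := by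
  simp only [Q.mem_points_iff]
  exact ⟨fun h a b hab ν hν => h ν hν a b hab, fun h ν hν a b hab => h a b hab ν hν⟩

/-- The morphism `[s]` of algebraic sets. -/
def AlgSet.ofHom {P Q : AlgSet Θ H} (s : Q.space ⟶ P.space)
    (h : ∀ ν ∈ P.points, ν.comp (FreeObj.hom s) ∈ Q.points) : P ⟶ Q :=
  ⟨fun ν => ⟨ν.1.comp (FreeObj.hom s), h ν.1 ν.2⟩, s, fun _ => rfl⟩

theorem AlgSet.hom_ext {P Q : AlgSet Θ H} {f g : P ⟶ Q}
    (h : ∀ ν, (f.1 ν).1 = (g.1 ν).1) : f = g :=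
  Subtype.ext (funext fun ν => Subtype.ext (h ν))

theorem AlgSet.exists_eq_ofHom {P Q : AlgSet Θ H} (f : P ⟶ Q) :
    ∃ (s : Q.space ⟶ P.space) (h : _), f = AlgSet.ofHom s h := by
  obtain ⟨s, hs⟩ := f.2
  refine ⟨s, fun ν hν => ?_, AlgSet.hom_ext hs⟩
  have := (f.1 ⟨ν, hν⟩).2
  rwa [hs] at this

theorem AlgSet.ofHom_eq_ofHom_iff {P Q : AlgSet Θ H} {s s' : Q.space ⟶ P.space}
    (h : ∀ ν ∈ P.points, ν.comp (FreeObj.hom s) ∈ Q.points)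
    (h' : ∀ ν ∈ P.points, ν.comp (FreeObj.hom s') ∈ Q.points) :
    (AlgSet.ofHom s h : P ⟶ Q) = AlgSet.ofHom s' h' ↔ tau Q.space P.cong s s' := by
  constructor
  · intro he a ν hν
    exact DFunLike.congr_fun (congrArg (fun f : P ⟶ Q => (f.1 ⟨ν, hν⟩).1) he) a
  · exact fun he => AlgSet.hom_ext fun ν => FirstOrder.Language.Hom.ext fun a => he a ν.1 ν.2

theorem isIdentityEmbedding_of_forall_eq {X : FreeObj Θ} {A B : Set (X.alg →[L] H)}
    {hA : ∃ T, A = solutions H X T} {hB : ∃ T, B = solutions H X T}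
    (f : AlgSet.mk X A hA ⟶ AlgSet.mk X B hB) (hf : ∀ ν, (f.1 ν).1 = ν.1) :
    IsIdentityEmbedding f := by
  have hAB : A ⊆ B := fun ν hν => by
    have := (f.1 ⟨ν, hν⟩).2
    rwa [hf] at this
  obtain rfl : f = AlgSet.inclusion hA hB hAB := AlgSet.hom_ext hf
  exact .intro _ _ _

end Galois

/-! ### The isomorphism of categories of algebraic sets induced by a similarity -/

section OfSimilarity

variable {L : FirstOrder.Language.{u, v}} [L.IsAlgebraic] {Θ₁ Θ₂ : Variety L}
  {H₁ : Type w₁} {H₂ : Type w₂} [L.Structure H₁] [L.Structure H₂]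
  (φ : FreeObj Θ₁ ⥤ FreeObj Θ₂)

variable (H₂) in
/-- The action of `φ` on algebraic sets: the algebraic set with closed congruence `α(φ)(A')`. -/
def algSetObj (P : AlgSet Θ₁ H₁) : AlgSet Θ₂ H₂ :=
  AlgSet.zeros H₂ (φ.obj P.space) (alpha φ P.space P.cong)

variable {φ}

omit [L.IsAlgebraic] in
theorem cong_algSetObj (hCl : IsClIso H₁ H₂ φ) (P : AlgSet Θ₁ H₁) :
    (algSetObj H₂ φ P).cong = alpha φ P.space P.cong :=
  AlgSet.cong_zeros ((hCl.bijOn P.space).mapsTo P.cong_mem_Cl)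

/-- `s` induces a map of algebraic sets if and only if `φ(s)` does. -/
theorem forall_comp_mem_algSetObj_iff (hτ : TauCompatible φ) [φ.Faithful]
    (hCl : IsClIso H₁ H₂ φ) {P Q : AlgSet Θ₁ H₁} (s : Q.space ⟶ P.space) :
    (∀ ν ∈ (algSetObj H₂ φ P).points,
      ν.comp (FreeObj.hom (φ.map s)) ∈ (algSetObj H₂ φ Q).points) ↔
    ∀ ν ∈ P.points, ν.comp (FreeObj.hom s) ∈ Q.points := by
  refine (AlgSet.forall_comp_mem_iff _ (algSetObj H₂ φ Q) (φ.map s)).trans ?_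
  refine Iff.trans ?_ (AlgSet.forall_comp_mem_iff _ Q s).symm
  change _ ≤ pullback (φ.map s) (algSetObj H₂ φ P).cong ↔ _ ≤ pullback s P.cong
  rw [cong_algSetObj hCl, cong_algSetObj hCl, ← hCl.natural s _ P.cong_mem_Cl]
  exact hτ.alpha_le_iff Q.cong_isCongruence
    (isCongruence_of_mem_Cl (pullback_mem_Cl s P.cong_mem_Cl))

omit [L.IsAlgebraic] in
theorem ofHom_map_eq_iff (hτ : TauCompatible φ) [φ.Faithful]
    (hCl : IsClIso H₁ H₂ φ) {P Q : AlgSet Θ₁ H₁} {s s' : Q.space ⟶ P.space} {h h' k k'} :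
    (AlgSet.ofHom (φ.map s) h : algSetObj H₂ φ P ⟶ algSetObj H₂ φ Q) =
      AlgSet.ofHom (φ.map s') h' ↔ (AlgSet.ofHom s k : P ⟶ Q) = AlgSet.ofHom s' k' := by
  refine (AlgSet.ofHom_eq_ofHom_iff _ _).trans (Iff.trans ?_ (AlgSet.ofHom_eq_ofHom_iff _ _).symm)
  rw [cong_algSetObj hCl]
  exact hτ.tau_iff P.cong_isCongruence

/-- The functor between the categories of algebraic sets induced by a similarity `φ`: it sends
`[s]` to `[φ(s)]`, where `s` is a chosen representative; the result does not depend on the choice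
(`algSetFunctor_map_ofHom`). -/
noncomputable def algSetFunctor (hτ : TauCompatible φ) [φ.Faithful] (hCl : IsClIso H₁ H₂ φ) :
    AlgSet Θ₁ H₁ ⥤ AlgSet Θ₂ H₂ where
  obj P := algSetObj H₂ φ P
  map {P Q} f := AlgSet.ofHom (φ.map (AlgSet.exists_eq_ofHom f).choose)
    ((forall_comp_mem_algSetObj_iff hτ hCl _).2 (AlgSet.exists_eq_ofHom f).choose_spec.choose)
  map_id P := by
    have h := (AlgSet.exists_eq_ofHom (𝟙 P)).choose_spec.choose_spec
    have h' : 𝟙 P = AlgSet.ofHom (𝟙 P.space) fun _ hν => hν := rfl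
    refine ((ofHom_map_eq_iff hτ hCl).2 (h.symm.trans h')).trans
      (b := AlgSet.ofHom (φ.map (𝟙 P.space)) fun ν hν => by rw [φ.map_id]; exact hν) ?_
    refine AlgSet.hom_ext fun ν => ?_
    change ν.1.comp (FreeObj.hom (φ.map (𝟙 _))) = ν.1
    rw [φ.map_id]
    rfl
  map_comp {P Q R} f g := by
    have h := (AlgSet.exists_eq_ofHom (f ≫ g)).choose_spec.choose_spec
    obtain ⟨hs, hf⟩ := (AlgSet.exists_eq_ofHom f).choose_spec
    obtain ⟨ht, hg⟩ := (AlgSet.exists_eq_ofHom g).choose_spec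
    set s := (AlgSet.exists_eq_ofHom f).choose
    set t := (AlgSet.exists_eq_ofHom g).choose
    have h' : f ≫ g = AlgSet.ofHom (t ≫ s) fun ν hν => ht _ (hs ν hν) := by
      conv_lhs => rw [hf, hg]
      rfl
    refine ((ofHom_map_eq_iff hτ hCl (h' := ?_)).2 (h.symm.trans h')).trans ?_
    · exact (forall_comp_mem_algSetObj_iff hτ hCl _).2 fun ν hν => ht _ (hs ν hν)
    · refine AlgSet.hom_ext fun ν => ?_
      change ν.1.comp (FreeObj.hom (φ.map (t ≫ s))) = _
      rw [φ.map_comp]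
      rfl

theorem algSetFunctor_map_ofHom (hτ : TauCompatible φ) [φ.Faithful] (hCl : IsClIso H₁ H₂ φ)
    {P Q : AlgSet Θ₁ H₁} (s : Q.space ⟶ P.space)
    (h : ∀ ν ∈ P.points, ν.comp (FreeObj.hom s) ∈ Q.points) :
    (algSetFunctor hτ hCl).map (AlgSet.ofHom s h : P ⟶ Q) =
      AlgSet.ofHom (φ.map s) ((forall_comp_mem_algSetObj_iff hτ hCl s).2 h) :=
  have hs := (AlgSet.exists_eq_ofHom (AlgSet.ofHom s h : P ⟶ Q)).choose_spec
  (ofHom_map_eq_iff hτ hCl (h := (forall_comp_mem_algSetObj_iff hτ hCl _).2 hs.choose)).2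
    hs.choose_spec.symm

theorem algSetFunctor_isIso (hτ : TauCompatible φ) [φ.IsIso] (hCl : IsClIso H₁ H₂ φ) :
    (algSetFunctor hτ hCl).IsIso where
  faithful := by
    refine ⟨fun {P Q} f g hfg => ?_⟩
    obtain ⟨s, hs, rfl⟩ := AlgSet.exists_eq_ofHom f
    obtain ⟨t, ht, rfl⟩ := AlgSet.exists_eq_ofHom g
    rw [algSetFunctor_map_ofHom, algSetFunctor_map_ofHom] at hfg
    exact (ofHom_map_eq_iff hτ hCl).1 hfg
  full := by
    refine ⟨fun {P Q} f => ?_⟩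
    obtain ⟨t, ht, rfl⟩ := AlgSet.exists_eq_ofHom f
    obtain ⟨s, rfl⟩ : ∃ s : Q.space ⟶ P.space, φ.map s = t := φ.map_surjective t
    exact ⟨AlgSet.ofHom s ((forall_comp_mem_algSetObj_iff hτ hCl s).1 ht),
      algSetFunctor_map_ofHom hτ hCl s _⟩
  bijective_obj := by
    constructor
    · rintro ⟨X, A, hA⟩ ⟨Y, B, hB⟩ h
      obtain rfl : X = Y := φ.bijective_obj.1 (congrArg AlgSet.space h)
      refine AlgSet.mk_eq_mk_of_commonKer_eq
        ((hCl.bijOn X).injOn (commonKer_mem_Cl A) (commonKer_mem_Cl B) ?_)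
      have hA' := cong_algSetObj hCl ⟨X, A, hA⟩
      have hB' := cong_algSetObj hCl ⟨X, B, hB⟩
      have hpts : (algSetObj H₂ φ ⟨X, A, hA⟩).points = (algSetObj H₂ φ ⟨X, B, hB⟩).points :=
        eq_of_heq (AlgSet.mk.inj h).2
      exact hA'.symm.trans ((congrArg commonKer hpts).trans hB')
    · rintro ⟨Y, B, hB⟩
      obtain ⟨X, rfl⟩ := φ.bijective_obj.2 Y
      obtain ⟨T, hT, hTB⟩ := (hCl.bijOn X).surjOn (commonKer_mem_Cl B)
      refine ⟨AlgSet.zeros H₁ X T, AlgSet.mk_eq_mk_of_commonKer_eq ?_⟩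
      refine (cong_algSetObj hCl _).trans ?_
      rw [AlgSet.cong_zeros hT]
      exact hTB

end OfSimilarity

/-! ### Correctness of the induced isomorphism -/

section Correctness

variable {L : FirstOrder.Language.{u, v}} [L.IsAlgebraic]
  {H₁ : Type w₁} {H₂ : Type w₂} [L.Structure H₁] [L.Structure H₂]

theorem correctlyIsomorphic_of_card_eq (φ : IsoCat (FreeObj (Var L H₁)) (FreeObj (Var L H₂)))
    (hτ : TauCompatible φ.functor) (hCl : IsClIso H₁ H₂ φ.functor)
    (hcard : ∀ X, Nat.card (φ.functor.obj X).vars = Nat.card X.vars) :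
    CorrectlyIsomorphic L H₁ H₂ := by
  have := algSetFunctor_isIso hτ hCl
  have haff : ∀ X, (algSetObj H₂ φ.functor (AlgSet.affine H₁ X)) =
      AlgSet.affine H₂ (φ.functor.obj X) := by
    intro X
    refine AlgSet.mk_eq_mk_of_commonKer_eq ((cong_algSetObj hCl _).trans ?_)
    -- Both sides are the equality relation, since the free algebras are separated by their points.
    ext a b
    refine ⟨fun h => ?_, fun h => ?_⟩
    · rw [alpha_eq_imp_eq φ.functor (fun c d hcd => ?_) h]
      · exact fun _ _ => rfl
      · exact Free.eq_of_forall_hom fun μ => hcd μ (Set.mem_univ μ)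
    · obtain rfl : a = b := Free.eq_of_forall_hom fun μ => h μ (Set.mem_univ μ)
      exact ((hCl.bijOn X).mapsTo (AlgSet.cong_mem_Cl (AlgSet.affine H₁ X))).elim
        fun B hB => (congrFun (congrFun hB a) a).mpr fun _ _ => rfl
  refine ⟨(algSetFunctor hτ hCl).asIsomorphism, fun X => ⟨_, hcard X, haff X⟩, ?_⟩
  intro X A hA
  refine isIdentityEmbedding_of_forall_eq _ fun ν => ?_
  refine (congrArg (fun f => (f.1 ν).1) (algSetFunctor_map_ofHom hτ hCl (P := ⟨X, A, hA⟩)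
    (Q := AlgSet.affine H₁ X) (𝟙 X) fun _ _ => Set.mem_univ _)).trans ?_
  change ν.1.comp (FreeObj.hom (φ.functor.map (𝟙 X))) = ν.1
  rw [φ.functor.map_id]
  rfl

end Correctness

/-! ### Trivial varieties and the passage from similarity to correct isomorphism -/

section Trivial

variable {L : FirstOrder.Language.{u, v}} [L.IsAlgebraic]

omit [L.IsAlgebraic] in
/-- In a variety whose free algebras have at most one element the whole space is the only
algebraic set. -/
theorem AlgSet.eq_affine {Θ : Variety L} {H : Type w} [L.Structure H]
    (hΘ : ∀ X : FreeObj Θ, Subsingleton X.alg) (P : AlgSet Θ H) :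
    P = AlgSet.affine H P.space := by
  obtain ⟨X, A, hA⟩ := P
  have := hΘ X
  exact AlgSet.mk_eq_mk_of_commonKer_eq <| funext fun a => funext fun b => by
    rw [Subsingleton.elim a b]
    exact propext ⟨fun _ _ _ => rfl, fun _ _ _ => rfl⟩

theorem AlgSet.nonempty_unique_hom {Θ : Variety L} {H : Type w} [L.Structure H]
    (hΘ : ∀ X : FreeObj Θ, Subsingleton X.alg) (P Q : AlgSet Θ H) : Nonempty (Unique (P ⟶ Q)) := by
  rw [AlgSet.eq_affine hΘ Q]
  have := hΘ P.space
  refine ⟨⟨AlgSet.ofHom (FreeObj.const _ (Free.of Θ (Classical.arbitrary _)))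
    fun _ _ => Set.mem_univ _⟩, fun f => ?_⟩
  obtain ⟨s, hs, rfl⟩ := AlgSet.exists_eq_ofHom f
  exact (AlgSet.ofHom_eq_ofHom_iff _ _).2 fun a ν _ => congrArg ν (Subsingleton.elim _ _)

theorem correctlyIsomorphic_of_subsingleton {H₁ : Type w₁} {H₂ : Type w₂} [L.Structure H₁]
    [L.Structure H₂] (h₁ : ∀ X : FreeObj (Var L H₁), Subsingleton X.alg)
    (h₂ : ∀ X : FreeObj (Var L H₂), Subsingleton X.alg) : CorrectlyIsomorphic L H₁ H₂ := by
  have u₁ : ∀ P Q : AlgSet (Var L H₁) H₁, Subsingleton (P ⟶ Q) := fun P Q =>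
    (AlgSet.nonempty_unique_hom h₁ P Q).elim fun _ => inferInstance
  have u₂ : ∀ P Q : AlgSet (Var L H₂) H₂, Subsingleton (P ⟶ Q) := fun P Q =>
    (AlgSet.nonempty_unique_hom h₂ P Q).elim fun _ => inferInstance
  let F : AlgSet (Var L H₁) H₁ ⥤ AlgSet (Var L H₂) H₂ :=
    { obj := fun P => AlgSet.affine H₂ ⟨P.space.vars⟩
      map := fun _ => (AlgSet.nonempty_unique_hom h₂ _ _).some.default
      map_id := fun _ => Subsingleton.elim _ _
      map_comp := fun _ _ => Subsingleton.elim _ _ }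
  have : F.IsIso :=
    { faithful := ⟨fun _ => Subsingleton.elim _ _⟩
      full := ⟨fun {P Q} _ => ⟨(AlgSet.nonempty_unique_hom h₁ P Q).some.default,
        Subsingleton.elim _ _⟩⟩
      bijective_obj := by
        refine ⟨fun P Q h => ?_, fun Q => ⟨AlgSet.affine H₁ ⟨Q.space.vars⟩, ?_⟩⟩
        · rw [AlgSet.eq_affine h₁ P, AlgSet.eq_affine h₁ Q]
          have hv : P.space.vars = Q.space.vars :=
            congrArg (fun R : AlgSet (Var L H₂) H₂ => R.space.vars) h
          obtain ⟨⟨X⟩, A, hA⟩ := P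
          obtain ⟨⟨Y⟩, B, hB⟩ := Q
          obtain rfl : X = Y := hv
          rfl
        · exact (AlgSet.eq_affine h₂ Q).symm }
  refine ⟨F.asIsomorphism, fun X => ⟨⟨X.vars⟩, rfl, rfl⟩, fun X A hA => ?_⟩
  have hid : ∀ f : AlgSet.affine H₂ (⟨X.vars⟩ : FreeObj (Var L H₂)) ⟶ AlgSet.affine H₂ ⟨X.vars⟩,
      IsIdentityEmbedding f := fun f =>
    isIdentityEmbedding_of_forall_eq f fun ν => by rw [Subsingleton.elim f (𝟙 _)]; rfl
  exact hid _

/-- Triviality of the free algebras is inherited along a full functor onto all objects. -/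
theorem subsingleton_alg_of_full {Θ₁ Θ₂ : Variety L} (φ : FreeObj Θ₁ ⥤ FreeObj Θ₂) [φ.Full]
    (hφ : Function.Surjective φ.obj) (h : ∀ X : FreeObj Θ₁, Subsingleton X.alg) (Y : FreeObj Θ₂) :
    Subsingleton Y.alg := by
  obtain ⟨X, rfl⟩ := hφ Y
  have := h X
  refine ⟨fun a b => ?_⟩
  obtain ⟨s, hs⟩ := φ.map_surjective (FreeObj.const (φ.obj X) a : φ.obj X ⟶ φ.obj X)
  obtain ⟨t, ht⟩ := φ.map_surjective (FreeObj.const (φ.obj X) b : φ.obj X ⟶ φ.obj X)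
  obtain rfl : s = t := FirstOrder.Language.Hom.ext fun c => Subsingleton.elim _ _
  have i := Classical.arbitrary (φ.obj X).vars
  rw [← FreeObj.const_of (φ.obj X) a i, ← FreeObj.const_of (φ.obj X) b i, ← hs, ← ht]

theorem correctlyIsomorphic_of_geometricallySimilar {H₁ : Type w₁} {H₂ : Type w₂} [L.Structure H₁]
    [L.Structure H₂] (hreg : (Var L H₁).IsRegular ∨ (Var L H₂).IsRegular)
    (h : GeometricallySimilar L H₁ H₂) : CorrectlyIsomorphic L H₁ H₂ := by
  obtain ⟨φ, hτ, hCl⟩ := h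
  -- If two generators coincide, both varieties are trivial and `φ` need not preserve ranks.
  by_cases hinj₁ : ∀ Z : Type, Function.Injective (Free.of (Var L H₁) : Z → _)
  swap
  · obtain ⟨Z, hZ⟩ := not_forall.1 hinj₁
    have h₁ : ∀ X : FreeObj (Var L H₁), Subsingleton X.alg := fun X =>
      Free.subsingleton_of_not_injective hZ (Free.contains X.vars)
    exact correctlyIsomorphic_of_subsingleton h₁
      (subsingleton_alg_of_full φ.functor φ.functor.bijective_obj.2 h₁)
  by_cases hinj₂ : ∀ Z : Type, Function.Injective (Free.of (Var L H₂) : Z → _)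
  swap
  · obtain ⟨Z, hZ⟩ := not_forall.1 hinj₂
    have h₂ : ∀ X : FreeObj (Var L H₂), Subsingleton X.alg := fun X =>
      Free.subsingleton_of_not_injective hZ (Free.contains X.vars)
    exact correctlyIsomorphic_of_subsingleton
      (subsingleton_alg_of_full φ.inverse φ.inverse.bijective_obj.2 h₂) h₂
  refine correctlyIsomorphic_of_card_eq φ hτ hCl fun X => ?_
  rcases hreg with hreg | hreg
  · have := card_vars_obj φ.symm hreg hinj₁ (φ.functor.obj X)
    rw [← this]
    exact congrArg (fun Z : FreeObj (Var L H₁) => Nat.card Z.vars)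
      (Functor.congr_obj φ.unit_eq X).symm
  · exact card_vars_obj φ hreg hinj₂ X

end Trivial

/-! ### Identity embeddings and maps of affine spaces -/

section Embeddings

variable {L : FirstOrder.Language.{u, v}} {Θ : Variety L} {H : Type w} [L.Structure H]

/-- The image of a morphism of algebraic sets, as a set of points of the affine space. -/
def AlgSet.image {P Q : AlgSet Θ H} (f : P ⟶ Q) : Set (Q.space.alg →[L] H) :=
  Set.range fun ν => (f.1 ν).1

theorem IsIdentityEmbedding.exists_eq_mk_image {P Q : AlgSet Θ H} {f : P ⟶ Q}
    (hf : IsIdentityEmbedding f) : ∃ h, P = AlgSet.mk Q.space (AlgSet.image f) h := by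
  obtain ⟨hA, hB, h⟩ := hf
  rename_i X A B
  have : A = AlgSet.image (AlgSet.inclusion hA hB h) :=
    Set.ext fun ν => ⟨fun hν => ⟨⟨ν, hν⟩, rfl⟩, by rintro ⟨ν, rfl⟩; exact ν.2⟩
  refine ⟨this ▸ hA, ?_⟩
  congr

/-- Morphisms into the target of an identity embedding factor through it as soon as their images
are contained in its image. -/
theorem IsIdentityEmbedding.exists_comp_eq_iff {P Q R : AlgSet Θ H} {f : P ⟶ Q}
    (hf : IsIdentityEmbedding f) (k : R ⟶ Q) :
    (∃ g : R ⟶ P, g ≫ f = k) ↔ ∀ ν, (k.1 ν).1 ∈ AlgSet.image f := by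
  constructor
  · rintro ⟨g, rfl⟩ ν
    exact ⟨g.1 ν, rfl⟩
  · intro h
    obtain ⟨hA, hB, hAB⟩ := hf
    obtain ⟨s, hs, rfl⟩ := AlgSet.exists_eq_ofHom k
    refine ⟨AlgSet.ofHom s fun ν hν => ?_, rfl⟩
    obtain ⟨μ, hμ⟩ := h ⟨ν, hν⟩
    have : ν.comp (FreeObj.hom s) = μ.1 := hμ.symm
    rw [this]
    exact μ.2

/-- The embedding of an algebraic set into its affine space. -/
def AlgSet.emb (P : AlgSet Θ H) : P ⟶ AlgSet.affine H P.space :=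
  AlgSet.inclusion P.isAlgebraic (AlgSet.affine H P.space).isAlgebraic (Set.subset_univ P.points)

/-- The map `[s]` of affine spaces. -/
def AlgSet.affineMap (H : Type w) [L.Structure H] {X Y : FreeObj Θ} (s : X ⟶ Y) :
    AlgSet.affine H Y ⟶ AlgSet.affine H X :=
  AlgSet.ofHom s fun _ _ => Set.mem_univ _

theorem AlgSet.emb_comp_affineMap_eq_iff (P : AlgSet Θ H) {Y : FreeObj Θ} {s s' : Y ⟶ P.space} :
    P.emb ≫ AlgSet.affineMap H s = P.emb ≫ AlgSet.affineMap H s' ↔ tau Y P.cong s s' :=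
  AlgSet.ofHom_eq_ofHom_iff (P := P) (Q := AlgSet.affine H Y) (s := s) (s' := s')
    (fun _ _ => Set.mem_univ _) (fun _ _ => Set.mem_univ _)

theorem AlgSet.exists_comp_emb_eq_iff (P Q : AlgSet Θ H) (s : Q.space ⟶ P.space) :
    (∃ g : P ⟶ Q, g ≫ Q.emb = P.emb ≫ AlgSet.affineMap H s) ↔ Q.cong ≤ pullback s P.cong := by
  refine Iff.trans ?_ (AlgSet.forall_comp_mem_iff P.points Q s)
  refine (IsIdentityEmbedding.exists_comp_eq_iff (.intro _ _ _) _).trans ⟨fun h ν hν => ?_,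
    fun h ν => ⟨⟨_, h ν.1 ν.2⟩, rfl⟩⟩
  obtain ⟨μ, hμ⟩ := h ⟨ν, hν⟩
  have : ν.comp (FreeObj.hom s) = μ.1 := hμ.symm
  rw [this]
  exact μ.2

/-- Over `Var(H)`, a homomorphism is determined by the map that it induces on all points. -/
theorem hom_eq_of_forall_comp_eq [L.IsAlgebraic] {X Y : FreeObj (Var L H)} {s s' : X ⟶ Y}
    (h : ∀ ν : Y.alg →[L] H, ν.comp (FreeObj.hom s) = ν.comp (FreeObj.hom s')) : s = s' :=
  FirstOrder.Language.Hom.ext fun a =>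
    Free.eq_of_forall_hom fun ν => DFunLike.congr_fun (h ν) a

end Embeddings

/-! ### The similarity induced by a correct isomorphism -/

section OfCorrect

variable {L : FirstOrder.Language.{u, v}}
  {H₁ : Type w₁} {H₂ : Type w₂} [L.Structure H₁] [L.Structure H₂]
  {F : IsoCat (AlgSet (Var L H₁) H₁) (AlgSet (Var L H₂) H₂)}

/-- The space of the image of the affine space over `W(X)` under `F`. -/
def affineObj (F : IsoCat (AlgSet (Var L H₁) H₁) (AlgSet (Var L H₂) H₂))
    (X : FreeObj (Var L H₁)) : FreeObj (Var L H₂) :=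
  (F.functor.obj (AlgSet.affine H₁ X)).space

theorem IsCorrect.obj_affine (hF : IsCorrect F) (X : FreeObj (Var L H₁)) :
    F.functor.obj (AlgSet.affine H₁ X) = AlgSet.affine H₂ (affineObj F X) := by
  obtain ⟨Y, -, hY⟩ := hF.affine X
  rw [affineObj, hY]
  rfl

theorem IsCorrect.mem_points (hF : IsCorrect F) {X : FreeObj (Var L H₁)}
    (ν : (affineObj F X).alg →[L] H₂) : ν ∈ (F.functor.obj (AlgSet.affine H₁ X)).points := by
  suffices ∀ P : AlgSet (Var L H₂) H₂, (∃ Y, P = AlgSet.affine H₂ Y) →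
      ∀ ν : P.space.alg →[L] H₂, ν ∈ P.points from this _ ⟨_, hF.obj_affine X⟩ ν
  rintro _ ⟨Y, rfl⟩ ν
  exact Set.mem_univ ν

/-- The homomorphism of free algebras which induces the image under `F` of the map `[s]` of affine
spaces; over `Var(H₂)` it is unique (`IsCorrect.affineHom_eq`). -/
noncomputable def affineHom (F : IsoCat (AlgSet (Var L H₁) H₁) (AlgSet (Var L H₂) H₂))
    {X Y : FreeObj (Var L H₁)} (s : X ⟶ Y) : affineObj F X ⟶ affineObj F Y :=
  (F.functor.map (AlgSet.affineMap H₁ s)).2.choose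

theorem map_affineMap_apply {X Y : FreeObj (Var L H₁)} (s : X ⟶ Y)
    (ν : (F.functor.obj (AlgSet.affine H₁ Y)).points) :
    ((F.functor.map (AlgSet.affineMap H₁ s)).1 ν).1 = ν.1.comp (FreeObj.hom (affineHom F s)) :=
  (F.functor.map (AlgSet.affineMap H₁ s)).2.choose_spec ν

theorem IsCorrect.isIdentityEmbedding_map_emb (hF : IsCorrect F) (P : AlgSet (Var L H₁) H₁) :
    IsIdentityEmbedding (F.functor.map P.emb) :=
  hF.embedding P.space P.points P.isAlgebraic

/-- Algebraic sets stay in the affine space which corresponds to their own. -/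
theorem IsCorrect.space_obj (hF : IsCorrect F) (P : AlgSet (Var L H₁) H₁) :
    (F.functor.obj P).space = affineObj F P.space := by
  obtain ⟨h, hP⟩ := (hF.isIdentityEmbedding_map_emb P).exists_eq_mk_image
  exact (congrArg AlgSet.space hP :)

/-- The closed congruence of the image under `F` of an algebraic set. -/
def imageCong (F : IsoCat (AlgSet (Var L H₁) H₁) (AlgSet (Var L H₂) H₂))
    (P : AlgSet (Var L H₁) H₁) : (affineObj F P.space).alg → (affineObj F P.space).alg → Prop :=
  commonKer (AlgSet.image (F.functor.map P.emb))

theorem IsCorrect.obj_eq (hF : IsCorrect F) (P : AlgSet (Var L H₁) H₁) :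
    F.functor.obj P = AlgSet.zeros H₂ (affineObj F P.space) (imageCong F P) := by
  obtain ⟨h, hP⟩ := (hF.isIdentityEmbedding_map_emb P).exists_eq_mk_image
  exact hP.trans (AlgSet.zeros_cong (AlgSet.mk _ _ h)).symm

theorem IsCorrect.affineObj_bijective (hF : IsCorrect F) :
    Function.Bijective (affineObj F) := by
  constructor
  · intro X Y h
    have : AlgSet.affine H₁ X = AlgSet.affine H₁ Y := F.functor.bijective_obj.1 <| by
      rw [hF.obj_affine, hF.obj_affine, h]
    exact congrArg AlgSet.space this
  · intro Y
    obtain ⟨P, hP⟩ := F.functor.bijective_obj.2 (AlgSet.affine H₂ Y)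
    refine ⟨P.space, ?_⟩
    rw [← hF.space_obj, hP]
    rfl

/-- The congruences of `P` and of its image induce corresponding relations on morphisms: both
say when two maps of affine spaces agree on the algebraic set. -/
theorem tau_imageCong_iff (P : AlgSet (Var L H₁) H₁) {Y : FreeObj (Var L H₁)} {s s' : Y ⟶ P.space} :
    tau (affineObj F Y) (imageCong F P) (affineHom F s) (affineHom F s') ↔ tau Y P.cong s s' := by
  rw [← AlgSet.emb_comp_affineMap_eq_iff, ← F.functor.map_injective.eq_iff, F.functor.map_comp,
    F.functor.map_comp]
  constructor
  · intro h
    refine AlgSet.hom_ext fun ν => (map_affineMap_apply s _).trans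
      (Eq.trans ?_ (map_affineMap_apply s' _).symm)
    exact FirstOrder.Language.Hom.ext fun a => h a _ ⟨ν, rfl⟩
  · rintro h a _ ⟨ν, rfl⟩
    have := congrArg (fun f => (f.1 ν).1) h
    exact DFunLike.congr_fun ((map_affineMap_apply s _).symm.trans
      (this.trans (map_affineMap_apply s' _))) a

/-- `s` induces a map of algebraic sets if and only if its image does for the images of these
sets: the condition is a factorization through identity embeddings. -/
theorem imageCong_le_pullback_iff (hF : IsCorrect F) (P Q : AlgSet (Var L H₁) H₁)
    (s : Q.space ⟶ P.space) :
    imageCong F Q ≤ pullback (affineHom F s) (imageCong F P) ↔ Q.cong ≤ pullback s P.cong := by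
  rw [← AlgSet.exists_comp_emb_eq_iff]
  trans ∃ g : F.functor.obj P ⟶ F.functor.obj Q, g ≫ F.functor.map Q.emb =
      F.functor.map P.emb ≫ F.functor.map (AlgSet.affineMap H₁ s)
  · obtain ⟨hQ, -⟩ := (hF.isIdentityEmbedding_map_emb Q).exists_eq_mk_image
    rw [(hF.isIdentityEmbedding_map_emb Q).exists_comp_eq_iff]
    have hmem := fun ν : (F.functor.obj P).points =>
      congrArg (· ∈ AlgSet.image (F.functor.map Q.emb))
        (map_affineMap_apply s ((F.functor.map P.emb).1 ν))
    refine (AlgSet.forall_comp_mem_iff (AlgSet.image (F.functor.map P.emb))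
      (AlgSet.mk (F.functor.obj (AlgSet.affine H₁ Q.space)).space _ hQ) (affineHom F s)).symm.trans
        ⟨fun h ν => ?_, ?_⟩
    · exact (hmem ν).mpr (h _ ⟨ν, rfl⟩)
    · rintro h _ ⟨ν, rfl⟩
      exact (hmem ν).mp (h ν)
  · constructor
    · rintro ⟨g, hg⟩
      obtain ⟨g, rfl⟩ := F.functor.map_surjective g
      rw [← F.functor.map_comp, ← F.functor.map_comp] at hg
      exact ⟨g, F.functor.map_injective hg⟩
    · rintro ⟨g, hg⟩
      exact ⟨F.functor.map g, by rw [← F.functor.map_comp, hg, F.functor.map_comp]⟩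

variable [L.IsAlgebraic]

theorem IsCorrect.affineHom_eq (hF : IsCorrect F) {X Y : FreeObj (Var L H₁)} {s : X ⟶ Y}
    {t : affineObj F X ⟶ affineObj F Y}
    (h : ∀ ν, ((F.functor.map (AlgSet.affineMap H₁ s)).1 ν).1 = ν.1.comp (FreeObj.hom t)) :
    affineHom F s = t :=
  hom_eq_of_forall_comp_eq fun ν =>
    (map_affineMap_apply s ⟨ν, hF.mem_points ν⟩).symm.trans (h ⟨ν, hF.mem_points ν⟩)

/-- The functor between the categories of free algebras induced by a correct isomorphism: over
`Var(H)` the category of affine spaces is opposite to the category of free algebras. -/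
noncomputable def affineFunctor (hF : IsCorrect F) :
    FreeObj (Var L H₁) ⥤ FreeObj (Var L H₂) where
  obj := affineObj F
  map := affineHom F
  map_id X := hF.affineHom_eq fun ν => by
    rw [show AlgSet.affineMap H₁ (𝟙 X) = 𝟙 _ from rfl, F.functor.map_id]
    rfl
  map_comp s t := hF.affineHom_eq fun ν => by
    rw [show AlgSet.affineMap H₁ (s ≫ t) = AlgSet.affineMap H₁ t ≫ AlgSet.affineMap H₁ s from rfl,
      F.functor.map_comp]
    refine (map_affineMap_apply s _).trans ?_
    rw [map_affineMap_apply t]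
    rfl

theorem affineFunctor_isIso (hF : IsCorrect F) : (affineFunctor hF).IsIso where
  faithful := by
    refine ⟨fun {X Y} s s' h => ?_⟩
    have hs : affineHom F s = affineHom F s' := h
    have : AlgSet.affineMap H₁ s = AlgSet.affineMap H₁ s' := F.functor.map_injective <|
      AlgSet.hom_ext fun ν => by rw [map_affineMap_apply, map_affineMap_apply, hs]
    exact hom_eq_of_forall_comp_eq fun ν =>
      congrArg (fun f => (f.1 ⟨ν, Set.mem_univ ν⟩).1) this
  full := by
    refine ⟨fun {X Y} t => ?_⟩
    obtain ⟨g, hg⟩ := F.functor.map_surjective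
      (AlgSet.ofHom t (fun _ _ => hF.mem_points _) :
        F.functor.obj (AlgSet.affine H₁ Y) ⟶ F.functor.obj (AlgSet.affine H₁ X))
    obtain ⟨s, hs, rfl⟩ := AlgSet.exists_eq_ofHom g
    refine ⟨s, hF.affineHom_eq fun ν => ?_⟩
    exact congrArg (fun f => (f.1 ν).1) hg
  bijective_obj := hF.affineObj_bijective

/-- The function `α` of the functor induced by `F` describes the action of `F` on algebraic
sets. -/
theorem alpha_affineFunctor (hF : IsCorrect F) (P : AlgSet (Var L H₁) H₁) :
    alpha (affineFunctor hF) P.space P.cong = imageCong F P := by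
  have := affineFunctor_isIso hF
  ext a b
  constructor
  · rintro ⟨c, _, _, rfl, rfl, s, s', h, rfl, rfl⟩
    exact (tau_imageCong_iff P).2 h c
  · intro h
    obtain ⟨s, hs⟩ := (affineFunctor hF).map_surjective
      (FreeObj.const _ a : (affineFunctor hF).obj P.space ⟶ _)
    obtain ⟨s', hs'⟩ := (affineFunctor hF).map_surjective
      (FreeObj.const _ b : (affineFunctor hF).obj P.space ⟶ _)
    refine ⟨Free.of _ (Classical.arbitrary _), FreeObj.const _ a, FreeObj.const _ b, rfl, rfl,
      s, s', ?_, hs, hs'⟩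
    rw [← tau_imageCong_iff (F := F)]
    have key := (tau_const_iff (W := affineObj F P.space)
      (commonKer_isCongruence (AlgSet.image (F.functor.map P.emb)))).2 h
    exact (congrArg₂ (tau (affineObj F P.space) (imageCong F P)) hs hs').mpr key

theorem alpha_affineFunctor_le_pullback_iff (hF : IsCorrect F) {X Y : FreeObj (Var L H₁)}
    (s : X ⟶ Y) {S : X.alg → X.alg → Prop} {T : Y.alg → Y.alg → Prop} (hS : S ∈ Cl H₁ X)
    (hT : T ∈ Cl H₁ Y) :
    alpha (affineFunctor hF) X S ≤
      pullback ((affineFunctor hF).map s) (alpha (affineFunctor hF) Y T) ↔ S ≤ pullback s T := by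
  have h := imageCong_le_pullback_iff hF (AlgSet.zeros H₁ Y T) (AlgSet.zeros H₁ X S) s
  rw [← alpha_affineFunctor hF, ← alpha_affineFunctor hF, AlgSet.cong_zeros hS,
    AlgSet.cong_zeros hT] at h
  exact h

theorem alpha_affineFunctor_bijOn (hF : IsCorrect F) (X : FreeObj (Var L H₁)) :
    Set.BijOn (alpha (affineFunctor hF) X) (Cl H₁ X) (Cl H₂ ((affineFunctor hF).obj X)) := by
  have hα : ∀ T ∈ Cl H₁ X, alpha (affineFunctor hF) X T = imageCong F (AlgSet.zeros H₁ X T) := by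
    intro T hT
    have := alpha_affineFunctor hF (AlgSet.zeros H₁ X T)
    rwa [AlgSet.cong_zeros hT] at this
  refine ⟨fun T hT => ?_, fun T hT S hS h => ?_, fun S hS => ?_⟩
  · rw [hα T hT]
    exact commonKer_mem_Cl _
  · rw [hα T hT, hα S hS] at h
    have : AlgSet.zeros H₁ X T = AlgSet.zeros H₁ X S := F.functor.bijective_obj.1 <| by
      rw [hF.obj_eq, hF.obj_eq]
      exact congrArg (AlgSet.zeros H₂ (affineObj F X)) h
    rw [← AlgSet.cong_zeros hT, ← AlgSet.cong_zeros hS]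
    exact congrArg commonKer (eq_of_heq (AlgSet.mk.inj this).2)
  · obtain ⟨P, hP⟩ := F.functor.bijective_obj.2 (AlgSet.zeros H₂ (affineObj F X) S)
    obtain rfl : P.space = X := hF.affineObj_bijective.1 <| by
      rw [← hF.space_obj, hP]
      rfl
    refine ⟨P.cong, P.cong_mem_Cl, ?_⟩
    rw [alpha_affineFunctor hF]
    have h := hF.obj_eq P
    rw [hP] at h
    rw [← AlgSet.cong_zeros (X := affineObj F P.space) (T := imageCong F P) (commonKer_mem_Cl _),
      ← AlgSet.cong_zeros (X := affineObj F P.space) hS]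
    exact congrArg commonKer (eq_of_heq (AlgSet.mk.inj h).2).symm

theorem isClIso_affineFunctor (hF : IsCorrect F) : IsClIso H₁ H₂ (affineFunctor hF) where
  bijOn := alpha_affineFunctor_bijOn hF
  natural {X Y} s T hT := by
    have hS := pullback_mem_Cl s hT
    refine le_antisymm ((alpha_affineFunctor_le_pullback_iff hF s hS hT).2 le_rfl) ?_
    -- The closed congruence on the right is in the image of `α`, so the order can be compared
    -- before applying `α`.
    obtain ⟨S, hS', hST⟩ := (alpha_affineFunctor_bijOn hF X).surjOn
      (pullback_mem_Cl ((affineFunctor hF).map s) ((alpha_affineFunctor_bijOn hF Y).mapsTo hT))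
    rw [← hST]
    exact alpha_mono _ ((alpha_affineFunctor_le_pullback_iff hF s hS' hT).1 hST.le)

theorem geometricallySimilar_of_correctlyIsomorphic (h : CorrectlyIsomorphic L H₁ H₂) :
    GeometricallySimilar L H₁ H₂ := by
  obtain ⟨F, hF⟩ := h
  have := affineFunctor_isIso hF
  exact ⟨(affineFunctor hF).asIsomorphism, tauCompatible_of_fullyFaithful (affineFunctor hF),
    isClIso_affineFunctor hF⟩

end OfCorrect

end UAG

theorem mainTheorem1 {L : FirstOrder.Language} [L.IsAlgebraic] (Θ : UAG.Variety L)
    (H₁ H₂ : Type*) [L.Structure H₁] [L.Structure H₂]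
    (hH₁ : Θ.Contains H₁) (hH₂ : Θ.Contains H₂)
    (hreg : (UAG.Var L H₁).IsRegular ∨ (UAG.Var L H₂).IsRegular) :
    UAG.CorrectlyIsomorphic L H₁ H₂ ↔ UAG.GeometricallySimilar L H₁ H₂ :=
  ⟨UAG.geometricallySimilar_of_correctlyIsomorphic,
    UAG.correctlyIsomorphic_of_geometricallySimilar hreg⟩
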